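/- Let $m>2$ be an integer, and let $q$ be an even prime power with $q\equiv -1 \pmod m$ (so $m$ is odd). Put $L=\lfloor q/(2m)\rfloor$ and $s=(m+1)/2$. Terminology. The Dickson polynomial of the first kind is $D_m(x,a)=\sum_{i=0}^{\lfloor m/2\rfloor}\frac{m}{m-i}\binom{m-i}{i}(-a)^i x^{m-2i}$. The minimum distance $d(\mathcal C)$ of a non-zero linear code $\mathcal C\subseteq\mathbb F_q^n$ is the least Hamming weight of a non-zero codeword. For integers $r\ge 1$, $\delta\ge 2$, a local repair group of $\mathcal C$ is a non-empty set $R\subseteq\{1,\dots,n\}$ with $|R|\le r+\delta-1$ such that the punctured code $\mathcal C_R=\{(c_i)_{i\in R}: c\in\mathcal C\}$ is $\{0\}$ or has minimum distance at least $\delta$. The code $\mathcal C$ is an $(r,\delta)$-LRC if every coordinate lies in some local repair group. Then the following hold. (1) For every $a\in\mathbb F_q^*$, the shifted Dickson polynomial $f(x)=D_m(x,a)-D_m(0,a)$ has exactly $(m+1)/2$ distinct roots in $\mathbb F_q$, and the number $G(f)$ of $t\in\mathbb F_q$ such that $f(x)+t$ has exactly $\deg f$ distinct roots in $\mathbb F_q$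 equals $\lfloor q/(2m)\rfloor$. (2) Let $\frac{m+1}{2}\le r\le m-1$, $\delta=m+1-r$, and $n=m\lfloor q/(2m)\rfloor+\frac{m+1}{2}$. For every integer $k$ with $$r\le k\le r\Big\lfloor\frac{q}{2m}\Big\rfloor+\frac{m+1}{2}-\delta+1$$ there is an $(r,\delta)$-LRC $\mathcal C\subseteq\mathbb F_q^n$ of dimension $k$ with minimum distance $$d(\mathcal C)=n-k-\Big(\Big\lceil\frac{k+(m-1)/2}{r}\Big\rceil-1\Big)(\delta-1)+1,$$ which is distance-optimal in the following sense: $\mathcal C$ has $L+1$ pairwise disjoint local repair groups, $L$ of them of size $r+\delta-1=m$ and one of size $s$, and every $(r,\delta)$-LRC $\mathcal C'\subseteq\mathbb F_q^n$ of dimension $k$ with $L+1$ pairwise disjoint local repair groups of these sizes satisfies $d(\mathcal C')\le d(\mathcal C)$. -/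

import Mathlib

open Classical in
/-- The minimum distance of a linear code: the least Hamming weight of a non-zero codeword.
(For the zero code, which has no non-zero codeword, the value is `0`.) -/
noncomputable def minDistance {F ι : Type*} [Field F] [Fintype ι] (C : Submodule F (ι → F)) : ℕ :=
  sInf {w : ℕ | ∃ c ∈ C, c ≠ 0 ∧ w = hammingNorm c}

/-- The punctured code `C_S = {(c_i)_{i ∈ S} : c ∈ C}`. -/
def puncture {F ι : Type*} [Field F] (C : Submodule F (ι → F)) (S : Finset ι) :
    Submodule F (S → F) :=
  C.map (LinearMap.funLeft F F (Subtype.val : S → ι))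

/-- `R` is a local repair group of `C` (for the locality parameters `r`, `δ`). -/
def IsLocalRepairGroup {F ι : Type*} [Field F] (C : Submodule F (ι → F)) (r δ : ℕ)
    (R : Finset ι) : Prop :=
  R.Nonempty ∧ R.card ≤ r + δ - 1 ∧ (puncture C R = ⊥ ∨ δ ≤ minDistance (puncture C R))

/-- `C` has `(r, δ)`-locality: every coordinate lies in a local repair group. -/
def IsLRC {F ι : Type*} [Field F] (C : Submodule F (ι → F)) (r δ : ℕ) : Prop :=
  ∀ i : ι, ∃ R : Finset ι, i ∈ R ∧ IsLocalRepairGroup C r δ R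

/-- `C` has `L + 1` pairwise disjoint local repair groups, the first `L` of which have
`r + δ - 1` elements, while the last one has `s` elements. -/
def HasDisjointRepairGroups {F ι : Type*} [Field F] (C : Submodule F (ι → F))
    (r δ L s : ℕ) : Prop :=
  ∃ A : Fin (L + 1) → Finset ι,
    Pairwise (fun i j => Disjoint (A i) (A j)) ∧
    (∀ i, IsLocalRepairGroup C r δ (A i)) ∧
    (∀ i : Fin L, (A i.castSucc).card = r + δ - 1) ∧
    (A (Fin.last L)).card = s

/-- `C` is a distance-optimal `(r, δ)`-LRC with respect to the repair-group structure `(L, s)`: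
it is an `(r, δ)`-LRC with this structure, and it has the largest minimum distance
among all such codes over the same field with the same length and dimension. -/
def IsDistanceOptimalLRC {F ι : Type*} [Field F] [Fintype ι] (C : Submodule F (ι → F))
    (r δ L s : ℕ) : Prop :=
  IsLRC C r δ ∧ HasDisjointRepairGroups C r δ L s ∧
    ∀ C' : Submodule F (ι → F), Module.finrank F C' = Module.finrank F C →
      IsLRC C' r δ → HasDisjointRepairGroups C' r δ L s → minDistance C' ≤ minDistance C

/-- The number of distinct roots of `f` in `F`. -/
noncomputable def numRoots {F : Type*} [Field F] (f : Polynomial F) : ℕ :=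
  {x : F | f.eval x = 0}.ncard

/-- `N_f(i)`: the number of `t ∈ F` such that `f + t` has exactly `i` distinct roots in `F`. -/
noncomputable def shiftCount {F : Type*} [Field F] (f : Polynomial F) (i : ℕ) : ℕ :=
  {t : F | numRoots (f + Polynomial.C t) = i}.ncard

/-- `G(f) = N_f(deg f)`. -/
noncomputable def splitCount {F : Type*} [Field F] (f : Polynomial F) : ℕ :=
  shiftCount f f.natDegree

/-- The shifted Dickson polynomial (of the first kind) `D_m(x, a) - D_m(0, a)`. -/
noncomputable def shiftedDickson {F : Type*} [Field F] (m : ℕ) (a : F) : Polynomial F :=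
  Polynomial.dickson 1 a m - Polynomial.C ((Polynomial.dickson 1 a m).eval 0)

/-! Part (1). In characteristic 2 write `a = b ^ 2`. The functional equation `D_m(b(z + z⁻¹), b²) =
b^m (z^m + z^(-m))` gives `D_m(0, a) = 0` and describes all fibres over an algebraic closure. Let `q
+ 1 = mN` with `N = 2L + 1`. A value `z + z⁻¹` lies in `F` exactly when `z^(q+1) = 1` or `z^(q-1) =
1`. The zero fibre comes from the `m`-th roots of unity, paired by inversion, so it has `(m+1)/2`
points. Over `t = b^m (w + w⁻¹)` with `w ≠ 1`, all `m` roots of `z^m = w` count if `w^N = 1`;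
otherwise only those with `z^(q-1) = 1` do, and coprimality of `m` and `q - 1` leaves at most one.
Hence the split values correspond to the `(N-1)/2 = L` inverse pairs of nontrivial `N`-th roots of
unity (`ncard_dickson_split_values`).

Part (2). Zeros in `|A| + 1 - δ` places of a repair group `A` force zeros on all of `A`. Spending
the dimension on the short group, on `l` full groups and on `b` further coordinates gives the upper
bound `HasDisjointRepairGroups.minDistance_add_le`. It is attained in `exists_code_of_fibers` by
evaluating polynomials on the `L` split fibres and the zero fibre. With `f = P * h`, where `P` has
the roots of `f` in `F` as simple roots, the code is spanned by `f ^ i * X ^ u / h`: this restricts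
to low degree on the zero fibre, and after multiplication by `h` on the others. -/

open Polynomial

/-! ### Minimum distance, repair groups and the upper bound -/

theorem minDistance_le_hammingNorm {F ι : Type*} [Field F] [Fintype ι] [DecidableEq F]
    {C : Submodule F (ι → F)} {c : ι → F} (hc : c ∈ C) (h0 : c ≠ 0) :
    minDistance C ≤ hammingNorm c := by
  refine Nat.sInf_le ⟨c, hc, h0, ?_⟩
  convert rfl

/-- The zero code is excluded because there the infimum of the empty set is `0`. -/
theorem le_minDistance {F ι : Type*} [Field F] [Fintype ι] [DecidableEq F]
    {C : Submodule F (ι → F)} (hC : C ≠ ⊥) {d : ℕ}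
    (h : ∀ c ∈ C, c ≠ 0 → d ≤ hammingNorm c) : d ≤ minDistance C := by
  obtain ⟨c, hc, h0⟩ := Submodule.exists_mem_ne_zero_of_ne_bot hC
  refine le_csInf ⟨_, c, hc, h0, rfl⟩ ?_
  rintro w ⟨c, hc, h0, rfl⟩
  refine (h c hc h0).trans_eq ?_
  convert rfl

/-- The restriction to `A` has weight at most `|A \ T| < δ`, so it cannot be a nonzero word of the
punctured code. -/
theorem IsLocalRepairGroup.eq_zero_of_subset {F ι : Type*} [Field F]
    {C : Submodule F (ι → F)} {r δ : ℕ} {A T : Finset ι} (hA : IsLocalRepairGroup C r δ A)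
    (hT : T ⊆ A) (hcard : A.card < T.card + δ) {c : ι → F} (hc : c ∈ C)
    (h : ∀ i ∈ T, c i = 0) : ∀ i ∈ A, c i = 0 := by
  classical
  set p : A → F := LinearMap.funLeft F F (Subtype.val : A → ι) c with hp
  have hpm : p ∈ puncture C A := Submodule.mem_map_of_mem hc
  suffices hp0 : p = 0 by
    intro i hi
    exact congrFun hp0 ⟨i, hi⟩
  rcases hA.2.2 with h0 | h0
  · rw [h0] at hpm
    exact (Submodule.mem_bot F).1 hpm
  · by_contra hne
    have h1 := h0.trans (minDistance_le_hammingNorm hpm hne)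
    have h2 : hammingNorm p ≤ (A \ T).card := by
      unfold hammingNorm
      refine Finset.card_le_card_of_injOn (fun i => i.1) ?_ (Subtype.val_injective.injOn)
      intro i hi
      simp only [Finset.coe_filter, Finset.mem_univ, true_and, Set.mem_ofPred_eq] at hi
      simp only [Finset.coe_sdiff, Set.mem_sdiff, Finset.mem_coe, i.2, true_and]
      intro hiT
      exact hi (h _ hiT)
    rw [Finset.card_sdiff_of_subset hT] at h2
    have := Finset.card_le_card hT
    omega

theorem exists_mem_ne_zero_vanishing {F ι : Type*} [Field F] [Finite ι]
    (C : Submodule F (ι → F)) (T : Finset ι) (h : T.card < Module.finrank F C) :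
    ∃ c ∈ C, c ≠ 0 ∧ ∀ i ∈ T, c i = 0 := by
  let φ : C →ₗ[F] (T → F) := (LinearMap.funLeft F F (Subtype.val : T → ι)) ∘ₗ C.subtype
  have hker : LinearMap.ker φ ≠ ⊥ := LinearMap.ker_ne_bot_of_finrank_lt (by simpa using h)
  obtain ⟨c, hc, h0⟩ := Submodule.exists_mem_ne_zero_of_ne_bot hker
  refine ⟨c, c.2, fun h => h0 (Subtype.ext h), fun i hi => ?_⟩
  exact congrFun (LinearMap.mem_ker.1 hc) ⟨i, hi⟩

/-- A Singleton-type bound for codes whose coordinates are partitioned by `L` repair groups of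
size `r + δ - 1` and one of size `s`. -/
theorem HasDisjointRepairGroups.minDistance_add_le {F : Type*} [Field F] {n r δ L s l b : ℕ}
    {C : Submodule F (Fin n → F)} (h : HasDisjointRepairGroups C r δ L s)
    (hn : n = (r + δ - 1) * L + s) (hδ : 1 ≤ δ) (hl : l < L) (hb : b < r)
    (hk : Module.finrank F C = (s + 1 - δ) + r * l + b + 1) :
    minDistance C + ((r + δ - 1) * l + s + b) ≤ n := by
  classical
  obtain ⟨A, hdisj, hloc, hcard, hlast⟩ := h
  -- The groups on which the codeword is made to vanish: the short one and the first `l` full ones.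
  set J : Finset (Fin (L + 1)) :=
    insert (Fin.last L) ((Finset.univ.filter fun i : Fin L => i.1 < l).image Fin.castSucc) with hJ
  have hJcard : (Finset.univ.filter fun i : Fin L => i.1 < l).card = l := by
    rw [Fin.card_filter_val_lt]; omega
  have hsum : ∀ g : Fin (L + 1) → ℕ, ∀ x, (∀ i : Fin L, g i.castSucc = x) →
      ∑ i ∈ J, g i = g (Fin.last L) + l * x := by
    intro g x hg
    rw [hJ, Finset.sum_insert, Finset.sum_image, Finset.sum_congr rfl (fun i _ => hg i),
      Finset.sum_const, hJcard, smul_eq_mul]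
    · exact fun _ _ _ _ h => Fin.castSucc_injective _ h
    · simp [Fin.castSucc_ne_last]
  have hT : ∀ i, ∃ T ⊆ A i, T.card = (A i).card + 1 - δ := fun i =>
    Finset.exists_subset_card_eq (by omega)
  choose T hTA hTcard using hT
  have hS : (J.biUnion A).card = (r + δ - 1) * l + s := by
    rw [Finset.card_biUnion (fun i _ j _ hij => hdisj hij), hsum _ _ hcard, hlast]
    ring
  have hT' : (J.biUnion T).card ≤ r * l + (s + 1 - δ) := by
    refine Finset.card_biUnion_le.trans ?_
    rw [hsum (fun i => (T i).card) r, hTcard, hlast]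
    · apply le_of_eq; ring
    · intro i
      rw [hTcard, hcard]
      omega
  have hml : (r + δ - 1) * l + (r + δ - 1) ≤ (r + δ - 1) * L := by
    rw [← Nat.mul_succ]
    exact Nat.mul_le_mul_left _ hl
  -- There is room for `b < r` further coordinates, since `l < L` leaves a full group untouched.
  obtain ⟨E, hE, hEcard⟩ := Finset.exists_subset_card_eq
    (s := (J.biUnion A)ᶜ) (n := b) (by
      rw [Finset.card_compl, hS, Fintype.card_fin]; omega)
  obtain ⟨c, hc, hc0, hcz⟩ := exists_mem_ne_zero_vanishing C (J.biUnion T ∪ E) (by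
    have := Finset.card_union_le (J.biUnion T) E
    omega)
  have hvan : ∀ i ∈ J.biUnion A ∪ E, c i = 0 := by
    intro i hi
    rcases Finset.mem_union.1 hi with hi | hi
    · obtain ⟨j, hj, hij⟩ := Finset.mem_biUnion.1 hi
      refine (hloc j).eq_zero_of_subset (hTA j) ?_ hc (fun i hi => ?_) i hij
      · rw [hTcard]; omega
      · exact hcz i (Finset.mem_union_left _ (Finset.mem_biUnion.2 ⟨j, hj, hi⟩))
    · exact hcz i (Finset.mem_union_right _ hi)
  have hw : hammingNorm c ≤ (J.biUnion A ∪ E)ᶜ.card := by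
    refine Finset.card_le_card fun i hi => ?_
    rw [Finset.mem_compl]
    intro h
    exact (Finset.mem_filter.1 hi).2 (hvan i h)
  have hdisjE : Disjoint (J.biUnion A) E := by
    rw [← Finset.subset_compl_iff_disjoint_left]
    exact hE
  rw [Finset.card_compl, Finset.card_union_of_disjoint hdisjE, hS, hEcard, Fintype.card_fin] at hw
  have h1 := minDistance_le_hammingNorm hc hc0
  have h2 : (J.biUnion A ∪ E).card ≤ n := by simpa using Finset.card_le_univ (J.biUnion A ∪ E)
  rw [Finset.card_union_of_disjoint hdisjE, hS, hEcard] at h2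
  omega

/-! ### Evaluation codes on the fibres of a polynomial -/

theorem card_filter_eval_eq_zero_le {F ι : Type*} [Field F] [DecidableEq F] {g : F[X]}
    (hg : g ≠ 0) {pt : ι → F} (hpt : Function.Injective pt) (B : Finset ι) :
    (B.filter fun j => g.eval (pt j) = 0).card ≤ g.natDegree := by
  rw [← Finset.card_image_of_injective _ hpt]
  refine Polynomial.card_le_degree_of_subset_roots fun x hx => ?_
  obtain ⟨j, hj, rfl⟩ := Finset.mem_image.1 hx
  exact (mem_roots hg).2 (Finset.mem_filter.1 hj).2

/-- Rescaling by the nonzero weights `w` preserves Hamming weight, and a nonzero `g` has at most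
`|B| - δ` zeros on `B`. -/
theorem isLocalRepairGroup_of_eval {F ι : Type*} [Field F] {C : Submodule F (ι → F)}
    {pt : ι → F} (hpt : Function.Injective pt) {r δ : ℕ} {B : Finset ι} (hB : B.Nonempty)
    (hcard : B.card ≤ r + δ - 1) (w : ι → F) (hw : ∀ j ∈ B, w j ≠ 0)
    (h : ∀ c ∈ C, ∃ g : F[X], g.natDegree + δ ≤ B.card ∧ ∀ j ∈ B, w j * c j = g.eval (pt j)) :
    IsLocalRepairGroup C r δ B := by
  classical
  refine ⟨hB, hcard, or_iff_not_imp_left.2 fun hne => le_minDistance hne ?_⟩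
  rintro _ ⟨c, hc, rfl⟩ hc0
  obtain ⟨g, hgd, hg⟩ := h c hc
  have hg0 : g ≠ 0 := by
    rintro rfl
    apply hc0
    ext j
    have := hg j.1 j.2
    rw [eval_zero, mul_eq_zero] at this
    exact this.resolve_left (hw _ j.2)
  have h1 := card_filter_eval_eq_zero_le hg0 hpt B
  have h2 := Finset.card_filter_add_card_filter_not (s := B) (fun j => g.eval (pt j) = 0)
  have h3 : (B.filter fun j => ¬ g.eval (pt j) = 0).card ≤
      hammingNorm (LinearMap.funLeft F F (Subtype.val : B → ι) c) := by
    unfold hammingNorm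
    rw [← Finset.card_image_of_injective _ (Subtype.val_injective (p := fun x => x ∈ B))]
    refine Finset.card_le_card fun j hj => ?_
    obtain ⟨hj, hgj⟩ := Finset.mem_filter.1 hj
    refine Finset.mem_image.2 ⟨⟨j, hj⟩, Finset.mem_filter.2 ⟨Finset.mem_univ _, ?_⟩, rfl⟩
    intro h0
    apply hgj
    rw [← hg j hj]
    have : c j = 0 := h0
    rw [this, mul_zero]
  omega

/-- At the largest index with a nonzero coefficient, the leading term cannot cancel. -/
theorem sum_smul_ne_zero_of_strictMono_natDegree {F : Type*} [Field F] {k : ℕ}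
    {e : Fin k → F[X]} (hm : ∀ j, (e j).Monic) (hd : StrictMono fun j => (e j).natDegree)
    {c : Fin k → F} (hc : c ≠ 0) : ∑ j, c j • e j ≠ 0 := by
  classical
  obtain ⟨j1, hj1⟩ := Function.ne_iff.1 hc
  obtain ⟨j0, hj0, hmax⟩ := Finset.exists_max_image (Finset.univ.filter fun j => c j ≠ 0) id
    ⟨j1, Finset.mem_filter.2 ⟨Finset.mem_univ _, hj1⟩⟩
  intro h
  have hcoe := congrArg (fun p => p.coeff (e j0).natDegree) h
  simp only [finsetSum_coeff, coeff_smul, coeff_zero, smul_eq_mul] at hcoe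
  rw [Finset.sum_eq_single j0, (hm j0).coeff_natDegree, mul_one] at hcoe
  · exact (Finset.mem_filter.1 hj0).2 hcoe
  · intro j _ hne
    by_cases hcj : c j = 0
    · rw [hcj, zero_mul]
    · have hle : j ≤ j0 := hmax j (Finset.mem_filter.2 ⟨Finset.mem_univ _, hcj⟩)
      rw [coeff_eq_zero_of_natDegree_lt (hd (lt_of_le_of_ne hle hne)), mul_zero]
  · simp

/-- The `j`-th polynomial spanning the code: after multiplication by `h` (of degree `a`) it is
`f ^ i * X ^ u`, where `f = P * h`, `j + a = r * i + u` and `u < r`. -/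
noncomputable def codePoly {F : Type*} [Field F] (P h : F[X]) (r a j : ℕ) : F[X] :=
  if (j + a) / r = 0 then X ^ ((j + a) % r - a)
  else P * (P * h) ^ ((j + a) / r - 1) * X ^ ((j + a) % r)

theorem codePoly_monic {F : Type*} [Field F] {P h : F[X]} (hP : P.Monic) (hh : h.Monic)
    (r a j : ℕ) : (codePoly P h r a j).Monic := by
  unfold codePoly
  split_ifs
  · exact monic_X_pow _
  · exact (hP.mul ((hP.mul hh).pow _)).mul (monic_X_pow _)

theorem natDegree_codePoly_add {F : Type*} [Field F] {P h : F[X]} (hP : P.Monic) (hh : h.Monic)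
    (r j : ℕ) : (codePoly P h r h.natDegree j).natDegree + h.natDegree =
      (P.natDegree + h.natDegree) * ((j + h.natDegree) / r) + (j + h.natDegree) % r := by
  have hdiv := Nat.div_add_mod (j + h.natDegree) r
  unfold codePoly
  split_ifs with h0
  · rw [h0] at hdiv ⊢
    rw [natDegree_X_pow]
    omega
  · obtain ⟨i, hi⟩ := Nat.exists_eq_succ_of_ne_zero h0
    rw [hi, (hP.mul ((hP.mul hh).pow _)).natDegree_mul (monic_X_pow _),
      hP.natDegree_mul ((hP.mul hh).pow _), (hP.mul hh).natDegree_pow, hP.natDegree_mul hh,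
      natDegree_X_pow, Nat.succ_sub_one, Nat.succ_eq_add_one]
    ring

/-- With `d = deg f - r`, the degree plus `deg h` equals `(j + deg h) + d * ((j + deg h) / r)`, and
the quotient is monotone in `j`. -/
theorem natDegree_codePoly_strictMono {F : Type*} [Field F] {P h : F[X]} (hP : P.Monic)
    (hh : h.Monic) {r : ℕ} (hr : r ≤ P.natDegree + h.natDegree) :
    StrictMono fun j => (codePoly P h r h.natDegree j).natDegree := by
  intro j j' hj
  have h1 := natDegree_codePoly_add hP hh r j
  have h2 := natDegree_codePoly_add hP hh r j'
  have h3 := Nat.div_add_mod (j + h.natDegree) r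
  have h4 := Nat.div_add_mod (j' + h.natDegree) r
  have h5 : (j + h.natDegree) / r ≤ (j' + h.natDegree) / r := Nat.div_le_div_right (by omega)
  obtain ⟨d, hd⟩ := Nat.exists_eq_add_of_le hr
  have h6 := Nat.mul_le_mul_left d h5
  rw [hd, add_mul] at h1 h2
  simp only
  omega

theorem mul_codePoly_eval {F : Type*} [Field F] {P h : F[X]} (r a j : ℕ) {x t : F}
    (ht : (P * h).eval x = t) :
    h.eval x * (codePoly P h r a j).eval x =
      (if (j + a) / r = 0 then h * X ^ ((j + a) % r - a)
        else C t ^ ((j + a) / r) * X ^ ((j + a) % r)).eval x := by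
  unfold codePoly
  split_ifs with h0
  · rw [eval_mul]
  · obtain ⟨i, hi⟩ := Nat.exists_eq_succ_of_ne_zero h0
    rw [hi, Nat.succ_sub_one, Nat.succ_eq_add_one]
    simp only [eval_mul, eval_pow, eval_C, eval_X, ← ht]
    ring

/-- A code built from a polynomial `f` which takes `L` non-zero values exactly `deg f` times,
and the value `0` at exactly `s` points. -/
theorem exists_code_of_fibers {F : Type*} [Field F] [Fintype F] [DecidableEq F] {f : F[X]}
    {m r δ L s n k l b : ℕ} (hf : f.Monic) (hfd : f.natDegree = m) (hrδ : r + δ = m + 1)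
    (hsm : s ≤ m) (hδ : 1 ≤ δ) (hδs : δ ≤ s) (τ : Fin (L + 1) → F) (hτ : Function.Injective τ)
    (hτ0 : τ (Fin.last L) = 0)
    (hcard : ∀ i : Fin L, (Finset.univ.filter fun x => f.eval x = τ i.castSucc).card = m)
    (hcard0 : (Finset.univ.filter fun x => f.eval x = 0).card = s)
    (hn : n = m * L + s) (hl : l < L) (hb : b < r) (hk : k + (m - s) = r * (l + 1) + b + 1) :
    ∃ C : Submodule F (Fin n → F), Module.finrank F C = k ∧ IsLRC C r δ ∧
      HasDisjointRepairGroups C r δ L s ∧ n ≤ minDistance C + (m * l + s + b) := by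
  classical
  -- the points and the groups
  have hcardP : (Finset.univ.filter fun x => ∃ i, f.eval x = τ i).card = n := by
    have : (Finset.univ.filter fun x => ∃ i, f.eval x = τ i) =
        Finset.univ.biUnion fun i => Finset.univ.filter fun x => f.eval x = τ i := by
      ext x; simp
    rw [this, Finset.card_biUnion, Fin.sum_univ_castSucc, Finset.sum_congr rfl
      (fun i _ => hcard i), hτ0, hcard0, hn]
    · simp [mul_comm]
    · intro i _ j _ hij
      refine Finset.disjoint_filter.2 fun x _ h1 h2 => hij (hτ (h1.symm.trans h2))
  let E := Finset.equivFinOfCardEq hcardP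
  let pt : Fin n → F := fun j => (E.symm j).1
  have hpt : Function.Injective pt := Subtype.val_injective.comp E.symm.injective
  have hptτ : ∀ j, ∃ i, f.eval (pt j) = τ i := fun j => (Finset.mem_filter.1 (E.symm j).2).2
  let B : Fin (L + 1) → Finset (Fin n) := fun i => Finset.univ.filter fun j => f.eval (pt j) = τ i
  have hBcard : ∀ i, (B i).card = (Finset.univ.filter fun x => f.eval x = τ i).card := by
    intro i
    rw [← Finset.card_image_of_injective _ hpt]
    congr 1
    ext x
    simp only [B, Finset.mem_image, Finset.mem_filter, Finset.mem_univ, true_and]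
    constructor
    · rintro ⟨j, hj, rfl⟩
      exact hj
    · intro hx
      have hxP : x ∈ Finset.univ.filter fun x => ∃ i, f.eval x = τ i := by
        simpa using ⟨i, hx⟩
      refine ⟨E ⟨x, hxP⟩, ?_, ?_⟩ <;> simp [pt, hx]
  have hBc : ∀ i : Fin L, (B i.castSucc).card = m := fun i => (hBcard _).trans (hcard i)
  have hBl : (B (Fin.last L)).card = s := by rw [hBcard, hτ0, hcard0]
  -- the factorization of `f`
  let P : F[X] := ∏ x ∈ Finset.univ.filter (fun x => f.eval x = 0), (X - C x)
  have hPm : P.Monic := monic_prod_of_monic _ _ fun x _ => monic_X_sub_C x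
  have hPd : P.natDegree = s := by
    rw [natDegree_prod_of_monic _ _ fun x _ => monic_X_sub_C x]
    simp [hcard0]
  have hPf : P ∣ f := by
    refine Finset.prod_dvd_of_coprime ?_ ?_
    · intro x _ y _ hxy
      exact pairwise_coprime_X_sub_C Function.injective_id hxy
    · intro x hx
      exact dvd_iff_isRoot.2 (Finset.mem_filter.1 hx).2
  obtain ⟨h, hfh⟩ := hPf
  have hhm : h.Monic := hPm.of_mul_monic_left (hfh ▸ hf)
  have hhd : h.natDegree = m - s := by
    have := hPm.natDegree_mul hhm
    rw [← hfh, hfd, hPd] at this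
    omega
  have hPh : P.natDegree + h.natDegree = m := by omega
  have hP0 : ∀ x, f.eval x = 0 → P.eval x = 0 := by
    intro x hx
    rw [eval_prod]
    exact Finset.prod_eq_zero (i := x) (by simpa using hx) (by simp)
  have hrpos : 0 < r := by omega
  let e : Fin k → F[X] := fun j => codePoly P h r (m - s) j
  have hem : ∀ j, (e j).Monic := fun j => codePoly_monic hPm hhm _ _ _
  have hsmono : StrictMono fun j : ℕ => (codePoly P h r (m - s) j).natDegree := by
    have := natDegree_codePoly_strictMono hPm hhm (r := r) (by omega)
    rwa [hhd] at this
  have hed : StrictMono fun j => (e j).natDegree := hsmono.comp Fin.val_strictMono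
  -- The top index `k - 1` shifts to `r * (l + 1) + b`, giving degree `m * (l + 1) + b - (m - s)`.
  have hdeg : ∀ j, (e j).natDegree ≤ m * l + s + b := by
    intro j
    have h1 : (e j).natDegree ≤ (codePoly P h r (m - s) (k - 1)).natDegree :=
      hsmono.monotone (by have := j.2; omega)
    have h2 := natDegree_codePoly_add hPm hhm r (k - 1)
    rw [hPh, hhd, show k - 1 + (m - s) = r * (l + 1) + b by have := j.2; omega,
      Nat.mul_add_mod, Nat.mod_eq_of_lt hb, Nat.mul_add_div hrpos, Nat.div_eq_of_lt hb,
      add_zero, mul_add, mul_one] at h2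
    omega
  let ev : F[X] →ₗ[F] (Fin n → F) := LinearMap.pi fun j => Polynomial.leval (pt j)
  let T : (Fin k → F) →ₗ[F] (Fin n → F) := ev ∘ₗ Fintype.linearCombination F e
  have hTv : ∀ c j, T c j = (∑ i, c i • e i).eval (pt j) := by
    intro c j
    simp [T, ev, Fintype.linearCombination_apply, eval_finsetSum]
  have hTs : ∀ c j, T c j = ∑ i, c i * (e i).eval (pt j) := by
    intro c j
    rw [hTv, eval_finsetSum]
    simp only [eval_smul, smul_eq_mul]
  have hwt : ∀ c, c ≠ 0 → n ≤ hammingNorm (T c) + (m * l + s + b) := by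
    intro c hc
    have hp0 := sum_smul_ne_zero_of_strictMono_natDegree hem hed hc
    have h1 := card_filter_eval_eq_zero_le hp0 hpt Finset.univ
    have h2 : (∑ i, c i • e i).natDegree ≤ m * l + s + b :=
      natDegree_sum_le_of_forall_le _ _ fun i _ => (natDegree_smul_le _ _).trans (hdeg i)
    have h3 := Finset.card_filter_add_card_filter_not (s := Finset.univ)
      (fun j : Fin n => (∑ i, c i • e i).eval (pt j) = 0)
    have h4 : hammingNorm (T c) =
        (Finset.univ.filter fun j => ¬ (∑ i, c i • e i).eval (pt j) = 0).card := by
      unfold hammingNorm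
      simp only [hTv, ne_eq]
    rw [Finset.card_univ, Fintype.card_fin] at h3
    omega
  have hlt : m * l + s + b < n := by
    have : m * (l + 1) ≤ m * L := Nat.mul_le_mul_left _ hl
    rw [mul_add, mul_one] at this
    omega
  have hTinj : Function.Injective T := by
    rw [injective_iff_map_eq_zero]
    intro c hc
    by_contra hne
    have := hwt c hne
    rw [hc, hammingNorm_zero] at this
    omega
  have hfin : Module.finrank F (LinearMap.range T) = k := by
    rw [LinearMap.finrank_range_of_inj hTinj]; simp
  have hloc : ∀ i, IsLocalRepairGroup (LinearMap.range T) r δ (B i) := by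
    intro i
    induction i using Fin.lastCases with
    | last =>
      refine isLocalRepairGroup_of_eval hpt (Finset.card_pos.1 (by omega)) (by omega)
        (fun _ => 1) (fun _ _ => one_ne_zero) ?_
      rintro _ ⟨c, rfl⟩
      -- On the zero fibre `P` kills every term with positive quotient; the surviving monomials have
      -- degree at most `r - 1 - (m - s) = s - δ`.
      refine ⟨∑ i, c i • (if (i.1 + (m - s)) / r = 0 then
        X ^ ((i.1 + (m - s)) % r - (m - s)) else 0), ?_, ?_⟩
      · have : (∑ i, c i • (if (i.1 + (m - s)) / r = 0 then
            (X : F[X]) ^ ((i.1 + (m - s)) % r - (m - s)) else 0)).natDegree ≤ s - δ := by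
          refine natDegree_sum_le_of_forall_le _ _ fun i _ => (natDegree_smul_le _ _).trans ?_
          split_ifs
          · rw [natDegree_X_pow]
            have := Nat.mod_lt (i.1 + (m - s)) hrpos
            omega
          · simp
        omega
      · intro j hj
        have hj0 : f.eval (pt j) = 0 := by rw [(Finset.mem_filter.1 hj).2, hτ0]
        rw [one_mul, hTs, eval_finsetSum]
        refine Finset.sum_congr rfl fun i _ => ?_
        rw [eval_smul, smul_eq_mul]
        congr 1
        simp only [e, codePoly]
        split_ifs
        · rfl
        · simp [hP0 _ hj0]
    | cast i =>
      have hti : τ i.castSucc ≠ 0 := by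
        rw [← hτ0]
        exact hτ.ne (Fin.castSucc_ne_last i)
      -- Since `f = P * h` is a nonzero constant on this fibre, `h` has no zero there.
      -- Multiplication by `h` turns `f ^ i * X ^ u / h` into a constant times `X ^ u` with `u < r`
      -- when `i > 0`, and a term with `i = 0` into a polynomial of degree `u`.
      refine isLocalRepairGroup_of_eval hpt (Finset.card_pos.1 (by rw [hBc]; omega))
        (by rw [hBc]; omega) (fun j => h.eval (pt j)) ?_ ?_
      · intro j hj h0
        apply hti
        rw [← (Finset.mem_filter.1 hj).2, hfh, eval_mul, h0, mul_zero]
      rintro _ ⟨c, rfl⟩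
      refine ⟨∑ i', c i' • (if (i'.1 + (m - s)) / r = 0 then
        h * X ^ ((i'.1 + (m - s)) % r - (m - s))
        else C (τ i.castSucc) ^ ((i'.1 + (m - s)) / r) * X ^ ((i'.1 + (m - s)) % r)), ?_, ?_⟩
      · have : (∑ i', c i' • (if (i'.1 + (m - s)) / r = 0 then
            h * X ^ ((i'.1 + (m - s)) % r - (m - s))
            else C (τ i.castSucc) ^ ((i'.1 + (m - s)) / r) *
              X ^ ((i'.1 + (m - s)) % r))).natDegree ≤ r - 1 := by
          refine natDegree_sum_le_of_forall_le _ _ fun i' _ => (natDegree_smul_le _ _).trans ?_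
          have := Nat.mod_lt (i'.1 + (m - s)) hrpos
          split_ifs
          · rw [hhm.natDegree_mul (monic_X_pow _), natDegree_X_pow]
            omega
          · rw [← C_pow]
            exact (natDegree_C_mul_X_pow_le _ _).trans (by omega)
        rw [hBc]
        omega
      · intro j hj
        have hjt : (P * h).eval (pt j) = τ i.castSucc := by
          rw [← hfh, (Finset.mem_filter.1 hj).2]
        rw [hTs, eval_finsetSum, Finset.mul_sum]
        refine Finset.sum_congr rfl fun i' _ => ?_
        rw [eval_smul, smul_eq_mul, ← mul_codePoly_eval r (m - s) i' hjt]
        simp only [e]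
        ring
  refine ⟨LinearMap.range T, hfin, ?_, ⟨B, ?_, hloc, ?_, hBl⟩, ?_⟩
  · intro j
    obtain ⟨i, hi⟩ := hptτ j
    exact ⟨B i, Finset.mem_filter.2 ⟨Finset.mem_univ _, hi⟩, hloc i⟩
  · intro i j hij
    exact Finset.disjoint_filter.2 fun x _ h1 h2 => hij (hτ (h1.symm.trans h2))
  · intro i
    rw [hBc]
    omega
  · have hne : LinearMap.range T ≠ ⊥ := by
      intro h0
      rw [h0, finrank_bot] at hfin
      rw [mul_add, mul_one] at hk
      omega
    suffices n - (m * l + s + b) ≤ minDistance (LinearMap.range T) by omega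
    refine le_minDistance hne ?_
    rintro _ ⟨c, rfl⟩ hc
    have := hwt c (by rintro rfl; exact hc (map_zero T))
    omega

/-! ### Dickson polynomials: functional equation and degree -/

theorem dickson_one_eval_add {R : Type*} [CommRing R] (x y : R) (n : ℕ) :
    (dickson 1 (x * y) n).eval (x + y) = x ^ n + y ^ n := by
  induction n using Nat.strong_induction_on with
  | _ n ih =>
    match n with
    | 0 => simp [dickson_zero]; norm_num
    | 1 => simp
    | n + 2 =>
      rw [dickson_add_two, eval_sub, eval_mul, eval_mul, eval_X, eval_C, ih _ (by omega),
        ih _ (by omega)]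
      ring

theorem dickson_monic_natDegree {R : Type*} [CommRing R] [Nontrivial R] (a : R) (n : ℕ)
    (hn : 0 < n) : (dickson 1 a n).Monic ∧ (dickson 1 a n).natDegree = n := by
  induction n using Nat.strong_induction_on with
  | _ n ih =>
    match n with
    | 1 => simp [monic_X]
    -- A separate case, since `D_0 = 2` is not monic of degree zero in general and the induction
    -- hypothesis needs a positive index.
    | 2 =>
      have h : dickson 1 a 2 = X ^ 2 - C (2 * a) := by
        rw [dickson_two, C_mul, mul_comm]
        have : (3 - (1 : ℕ) : R[X]) = 2 := by norm_num
        rw [this]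
        rfl
      rw [h]
      exact ⟨monic_X_pow_sub_C _ two_ne_zero, natDegree_X_pow_sub_C⟩
    | n + 3 =>
      obtain ⟨h1, h2⟩ := ih (n + 2) (by omega) (by omega)
      obtain ⟨h3, h4⟩ := ih (n + 1) (by omega) (by omega)
      rw [dickson_add_two 1 a (n + 1)]
      have hX : (X * dickson 1 a (n + 2)).Monic := monic_X.mul h1
      have hXd : (X * dickson 1 a (n + 2)).natDegree = n + 3 := by
        rw [monic_X.natDegree_mul h1, h2, natDegree_X]; omega
      have hlt : (C a * dickson 1 a (n + 1)).natDegree < (X * dickson 1 a (n + 2)).natDegree := by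
        rw [hXd]
        exact (natDegree_C_mul_le _ _).trans_lt (by omega)
      exact ⟨hX.sub_of_left (degree_lt_degree hlt),
        (natDegree_sub_eq_left_of_natDegree_lt hlt).trans hXd⟩

/-! ### The map `z ↦ z + z⁻¹` and rationality over a finite field -/

/-- The elements of `F` already exhaust the roots of `X ^ q - X`, whose degree is `q`. -/
theorem mem_range_algebraMap_of_pow_card {F K : Type*} [Field F] [Fintype F] [Field K]
    [Algebra F K] {x : K} (hx : x ^ Fintype.card F = x) : x ∈ Set.range (algebraMap F K) := by
  classical
  have h1 : (X ^ Fintype.card F - X : K[X]) ≠ 0 :=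
    FiniteField.X_pow_card_sub_X_ne_zero K Fintype.one_lt_card
  have h2 : Finset.univ.image (algebraMap F K) ⊆ (X ^ Fintype.card F - X : K[X]).roots.toFinset := by
    intro y hy
    obtain ⟨x, -, rfl⟩ := Finset.mem_image.1 hy
    rw [Multiset.mem_toFinset, mem_roots h1]
    simp [← map_pow, FiniteField.pow_card]
  have h3 := Finset.eq_of_subset_of_card_le h2 (by
    rw [Finset.card_image_of_injective _ (algebraMap F K).injective, Finset.card_univ]
    refine (Multiset.toFinset_card_le _).trans ((card_roots' _).trans ?_)
    rw [FiniteField.X_pow_card_sub_X_natDegree_eq K Fintype.one_lt_card])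
  have h4 : x ∈ (X ^ Fintype.card F - X : K[X]).roots.toFinset := by
    rw [Multiset.mem_toFinset, mem_roots h1]
    simp [hx]
  rw [← h3] at h4
  obtain ⟨y, -, hy⟩ := Finset.mem_image.1 h4
  exact ⟨y, hy⟩

theorem add_inv_eq_add_inv_iff {K : Type*} [Field K] {z w : K} (hz : z ≠ 0) (hw : w ≠ 0) :
    z + z⁻¹ = w + w⁻¹ ↔ z = w ∨ z = w⁻¹ := by
  have h : (z + z⁻¹ - (w + w⁻¹)) * (z * w) = (z - w) * (z * w - 1) := by
    field_simp
    ring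
  rw [← sub_eq_zero, ← mul_left_inj' (mul_ne_zero hz hw), h, zero_mul, mul_eq_zero, sub_eq_zero,
    sub_eq_zero, ← mul_eq_one_iff_eq_inv₀ hw]

theorem exists_add_inv_eq {K : Type*} [Field K] [IsAlgClosed K] (x : K) :
    ∃ z : K, z ≠ 0 ∧ z + z⁻¹ = x := by
  obtain ⟨z, hz⟩ := IsAlgClosed.exists_root (C 1 * X ^ 2 + C (-x) * X + C 1 : K[X])
    (by rw [degree_quadratic one_ne_zero]; norm_num)
  have hz' : z ^ 2 - x * z + 1 = 0 := by
    have : z ^ 2 + -(x * z) + 1 = 0 := by simpa [IsRoot.def] using hz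
    rw [← this]; ring
  have hz0 : z ≠ 0 := by
    rintro rfl
    simp at hz'
  refine ⟨z, hz0, ?_⟩
  field_simp
  linear_combination hz'

theorem add_inv_eq_zero_iff {K : Type*} [Field K] [CharP K 2] {z : K} (hz : z ≠ 0) :
    z + z⁻¹ = 0 ↔ z = 1 := by
  have := add_inv_eq_add_inv_iff hz (one_ne_zero (α := K))
  rwa [inv_one, CharTwo.add_self_eq_zero, or_self] at this

/-- The fibres are the pairs `{z, z⁻¹}`, which collapse only at `z = 1`; so `N = 1 + 2 (c - 1)` for
an image of size `c`. -/
theorem card_image_add_inv_nthRoots {K : Type*} [Field K] [CharP K 2] [DecidableEq K] {N : ℕ}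
    (hN : Odd N) {ζ : K} (hζ : IsPrimitiveRoot ζ N) :
    ((nthRootsFinset N (1 : K)).image fun z => z + z⁻¹).card = (N + 1) / 2 := by
  have hmem : ∀ z : K, z ∈ nthRootsFinset N (1 : K) ↔ z ^ N = 1 := fun z =>
    mem_nthRootsFinset hN.pos 1
  have hne : ∀ z : K, z ^ N = 1 → z ≠ 0 := by
    rintro z hz rfl
    rw [zero_pow hN.pos.ne'] at hz
    exact zero_ne_one hz
  set S := nthRootsFinset N (1 : K) with hS
  have h0 : (0 : K) ∈ S.image fun z => z + z⁻¹ :=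
    Finset.mem_image.2 ⟨1, (hmem 1).2 (one_pow N), by simp [CharTwo.add_self_eq_zero]⟩
  have h1 := Finset.card_eq_sum_card_image (fun z : K => z + z⁻¹) S
  rw [hζ.card_nthRootsFinset, ← Finset.add_sum_erase _ _ h0, Finset.sum_congr rfl
    (g := fun _ => 2), Finset.sum_const, Finset.card_erase_of_mem h0, smul_eq_mul] at h1
  · have h2 : (S.filter fun z => z + z⁻¹ = 0).card = 1 := by
      rw [Finset.card_eq_one]
      refine ⟨1, ?_⟩
      ext z
      rw [Finset.mem_filter, Finset.mem_singleton, hmem]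
      constructor
      · rintro ⟨hz, hz0⟩
        exact (add_inv_eq_zero_iff (hne z hz)).1 hz0
      · rintro rfl
        exact ⟨one_pow N, (add_inv_eq_zero_iff one_ne_zero).2 rfl⟩
    rw [h2] at h1
    have := Finset.card_pos.2 ⟨_, h0⟩
    omega
  · intro x hx
    obtain ⟨hx0, hx⟩ := Finset.mem_erase.1 hx
    obtain ⟨w, hw, rfl⟩ := Finset.mem_image.1 hx
    rw [hmem] at hw
    have hw0 := hne w hw
    rw [Finset.card_eq_two]
    refine ⟨w, w⁻¹, ?_, ?_⟩
    · intro h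
      apply hx0
      rw [← h, CharTwo.add_self_eq_zero]
    · ext z
      rw [Finset.mem_filter, hmem, Finset.mem_insert, Finset.mem_singleton]
      constructor
      · rintro ⟨hz, hzw⟩
        exact (add_inv_eq_add_inv_iff (hne z hz) hw0).1 hzw
      · rintro (rfl | rfl)
        · exact ⟨hw, rfl⟩
        · exact ⟨by rw [inv_pow, hw, inv_one], by rw [inv_inv, add_comm]⟩

section DicksonRoots

variable {F K : Type*} [Field F] [Fintype F] [Field K] [Algebra F K]

/-- Frobenius fixes `z + z⁻¹`, so it sends `z` to `z` or to `z⁻¹`. -/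
theorem pow_card_add_one_or_of_add_inv {p : ℕ} [CharP K p] (hp : ringChar F = p) {z : K}
    (hz : z ≠ 0) (hx : z + z⁻¹ ∈ Set.range (algebraMap F K)) :
    z ^ (Fintype.card F + 1) = 1 ∨ z ^ (Fintype.card F - 1) = 1 := by
  obtain ⟨x, hx⟩ := hx
  have hadd : (z + z⁻¹) ^ Fintype.card F = z ^ Fintype.card F + (z ^ Fintype.card F)⁻¹ := by
    have : CharP F p := hp ▸ ringChar.charP F
    obtain ⟨n, hprime, hn⟩ := FiniteField.card F p
    have := Fact.mk hprime
    rw [hn, add_pow_char_pow, inv_pow]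
  have h : z ^ Fintype.card F + (z ^ Fintype.card F)⁻¹ = z + z⁻¹ := by
    rw [← hadd, ← hx, ← map_pow, FiniteField.pow_card]
  rcases (add_inv_eq_add_inv_iff (pow_ne_zero _ hz) hz).1 h with h | h
  · right
    have h1 : z ^ (Fintype.card F - 1) * z = 1 * z := by
      rw [← pow_succ, Nat.sub_add_cancel Fintype.card_pos, h, one_mul]
    exact mul_right_cancel₀ hz h1
  · left
    rw [pow_succ, h, inv_mul_cancel₀ hz]

theorem add_inv_mem_range_of_pow_card_add_one {p : ℕ} [CharP K p] (hp : ringChar F = p) {z : K}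
    (hz : z ^ (Fintype.card F + 1) = 1) : z + z⁻¹ ∈ Set.range (algebraMap F K) := by
  apply mem_range_algebraMap_of_pow_card
  have : CharP F p := hp ▸ ringChar.charP F
  obtain ⟨n, hprime, hn⟩ := FiniteField.card F p
  have := Fact.mk hprime
  have hzq : z ^ Fintype.card F = z⁻¹ := by
    refine eq_inv_of_mul_eq_one_left ?_
    rw [← pow_succ, hz]
  rw [hn] at hzq ⊢
  rw [add_pow_char_pow, inv_pow, hzq, inv_inv, add_comm]

end DicksonRoots

/-! ### Fibres of Dickson polynomials -/

theorem algebraMap_dickson_eval {F K : Type*} [Field F] [Field K] [Algebra F K] {b x : F} {z : K} (hz : z ≠ 0) (m : ℕ)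
    (hx : algebraMap F K x = algebraMap F K b * (z + z⁻¹)) :
    algebraMap F K ((dickson 1 (b ^ 2) m).eval x) =
      algebraMap F K b ^ m * (z ^ m + (z ^ m)⁻¹) := by
  have h := dickson_one_eval_add (algebraMap F K b * z) (algebraMap F K b * z⁻¹) m
  rw [← mul_add, ← hx, show algebraMap F K b * z * (algebraMap F K b * z⁻¹) =
    algebraMap F K (b ^ 2) by rw [map_pow]; field_simp, ← map_dickson, eval_map_algebraMap,
    aeval_algebraMap_apply, mul_pow, mul_pow, ← mul_add, inv_pow] at h
  exact h

section DicksonFibers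

variable {F : Type*} [Field F]

theorem exists_algebraMap_eq_mul_add_inv (K : Type*) [Field K] [Algebra F K] [IsAlgClosed K]
    {b : F} (hb : b ≠ 0) (x : F) :
    ∃ z : K, z ≠ 0 ∧ algebraMap F K x = algebraMap F K b * (z + z⁻¹) := by
  obtain ⟨z, hz, hzx⟩ := exists_add_inv_eq (algebraMap F K x / algebraMap F K b)
  refine ⟨z, hz, ?_⟩
  rw [hzx, mul_div_cancel₀]
  exact (_root_.map_ne_zero _).2 hb

theorem exists_isPrimitiveRoot_of_odd (K : Type*) [Field K] [IsAlgClosed K] [CharP K 2] {N : ℕ}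
    (hN : Odd N) : ∃ ζ : K, IsPrimitiveRoot ζ N := by
  have : NeZero (N : K) := ⟨by
    rw [Ne, CharP.cast_eq_zero_iff K 2]
    exact fun h => Nat.not_even_iff_odd.2 hN (even_iff_two_dvd.2 h)⟩
  exact HasEnoughRootsOfUnity.exists_primitiveRoot K N

/-- A parameter of `x` satisfies `z ^ m = w` or `z ^ m = w⁻¹`; in the second case `z⁻¹` serves
instead. -/
theorem exists_pow_eq_of_dickson_eval_eq {K : Type*} [Field K] [Algebra F K] [IsAlgClosed K] {m : ℕ}
    {b : F} (hb : b ≠ 0) {t x : F} {w : K} (hw : w ≠ 0)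
    (ht : algebraMap F K t = algebraMap F K b ^ m * (w + w⁻¹))
    (hx : (dickson 1 (b ^ 2) m).eval x = t) :
    ∃ z : K, z ≠ 0 ∧ z ^ m = w ∧ algebraMap F K x = algebraMap F K b * (z + z⁻¹) := by
  have hφb : algebraMap F K b ≠ 0 := (_root_.map_ne_zero _).2 hb
  obtain ⟨z, hz, hzx⟩ := exists_algebraMap_eq_mul_add_inv K hb x
  have h := algebraMap_dickson_eval hz m hzx
  rw [hx, ht, mul_right_inj' (pow_ne_zero _ hφb), eq_comm,
    add_inv_eq_add_inv_iff (pow_ne_zero _ hz) hw] at h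
  rcases h with h | h
  · exact ⟨z, hz, h, hzx⟩
  · exact ⟨z⁻¹, inv_ne_zero hz, by rw [inv_pow, h, inv_inv], by rw [hzx, inv_inv, add_comm z]⟩

variable [Fintype F] {m N : ℕ} {b : F}

theorem ncard_dickson_eval_eq_zero (h2 : ringChar F = 2) (hb : b ≠ 0) (hm : Odd m)
    (hmN : Fintype.card F + 1 = m * N) :
    {x : F | (dickson 1 (b ^ 2) m).eval x = 0}.ncard = (m + 1) / 2 := by
  classical
  let K := AlgebraicClosure F
  have : CharP F 2 := h2 ▸ ringChar.charP F
  have : CharP K 2 := charP_of_injective_algebraMap (algebraMap F K).injective 2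
  obtain ⟨ζ, hζ⟩ := exists_isPrimitiveRoot_of_odd K hm
  have hφb : algebraMap F K b ≠ 0 := (_root_.map_ne_zero _).2 hb
  have himg : algebraMap F K '' {x : F | (dickson 1 (b ^ 2) m).eval x = 0} =
      (((nthRootsFinset m (1 : K)).image fun z => z + z⁻¹).image (algebraMap F K b * ·) :
        Finset K) := by
    ext y
    simp only [Set.mem_image, Set.mem_ofPred_eq, Finset.coe_image, Finset.mem_coe,
      mem_nthRootsFinset hm.pos, exists_exists_and_eq_and]
    constructor
    · rintro ⟨x, hx, rfl⟩
      obtain ⟨z, hz, hzx⟩ := exists_algebraMap_eq_mul_add_inv K hb x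
      refine ⟨z, ?_, hzx.symm⟩
      have h := algebraMap_dickson_eval hz m hzx
      rw [hx, map_zero, zero_eq_mul, or_iff_right (pow_ne_zero _ hφb)] at h
      exact (add_inv_eq_zero_iff (pow_ne_zero _ hz)).1 h
    · rintro ⟨z, hz, rfl⟩
      have hz0 : z ≠ 0 := by
        rintro rfl
        rw [zero_pow hm.pos.ne'] at hz
        exact zero_ne_one hz
      obtain ⟨x, hx⟩ := add_inv_mem_range_of_pow_card_add_one (F := F) h2 (z := z)
        (by rw [hmN, pow_mul, hz, one_pow])
      have hxb : algebraMap F K (b * x) = algebraMap F K b * (z + z⁻¹) := by rw [map_mul, hx]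
      refine ⟨b * x, ?_, hxb⟩
      apply (algebraMap F K).injective
      rw [algebraMap_dickson_eval hz0 m hxb, hz, inv_one, CharTwo.add_self_eq_zero, mul_zero,
        map_zero]
  rw [← Set.ncard_image_of_injective _ (algebraMap F K).injective, himg, Set.ncard_coe_finset,
    Finset.card_image_of_injective _ (mul_right_injective₀ hφb), card_image_add_inv_nthRoots hm hζ]

variable {K : Type*} [Field K] [Algebra F K] [IsAlgClosed K] [CharP K 2]

/-- Every root of `z ^ m = w` satisfies `z ^ (q + 1) = w ^ N = 1`, hence gives a point of `F`. Two
roots cannot be inverse to each other, since that would force `w = w⁻¹` and so `w = 1`. -/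
theorem ncard_dickson_fiber_of_pow_eq_one (h2 : ringChar F = 2) (hb : b ≠ 0) (hm : Odd m)
    (hmN : Fintype.card F + 1 = m * N) {t : F} {w : K} (hw : w ≠ 0) (hw1 : w ≠ 1)
    (ht : algebraMap F K t = algebraMap F K b ^ m * (w + w⁻¹)) (hwN : w ^ N = 1) :
    {x : F | (dickson 1 (b ^ 2) m).eval x = t}.ncard = m := by
  classical
  obtain ⟨ζ, hζ⟩ := exists_isPrimitiveRoot_of_odd K hm
  have hφb : algebraMap F K b ≠ 0 := (_root_.map_ne_zero _).2 hb
  have hne : ∀ z : K, z ^ m = w → z ≠ 0 := by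
    rintro z hz rfl
    rw [zero_pow hm.pos.ne'] at hz
    exact hw hz.symm
  have himg : algebraMap F K '' {x : F | (dickson 1 (b ^ 2) m).eval x = t} =
      ((nthRootsFinset m w).image fun z => algebraMap F K b * (z + z⁻¹) : Finset K) := by
    ext y
    simp only [Set.mem_image, Set.mem_ofPred_eq, Finset.coe_image, Finset.mem_coe,
      mem_nthRootsFinset hm.pos]
    constructor
    · rintro ⟨x, hx, rfl⟩
      obtain ⟨z, -, hzw, hzx⟩ := exists_pow_eq_of_dickson_eval_eq hb hw ht hx
      exact ⟨z, hzw, hzx.symm⟩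
    · rintro ⟨z, hz, rfl⟩
      obtain ⟨x, hx⟩ := add_inv_mem_range_of_pow_card_add_one (F := F) h2 (z := z)
        (by rw [hmN, pow_mul, hz, hwN])
      have hxb : algebraMap F K (b * x) = algebraMap F K b * (z + z⁻¹) := by rw [map_mul, hx]
      refine ⟨b * x, ?_, hxb⟩
      apply (algebraMap F K).injective
      rw [algebraMap_dickson_eval (hne z hz) m hxb, hz, ht]
  have hinj : Set.InjOn (fun z : K => algebraMap F K b * (z + z⁻¹)) (nthRootsFinset m w) := by
    intro z hz z' hz' h
    rw [Finset.mem_coe, mem_nthRootsFinset hm.pos] at hz hz'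
    rcases (add_inv_eq_add_inv_iff (hne z hz) (hne z' hz')).1 (mul_left_cancel₀ hφb h) with h | h
    · exact h
    · exfalso
      apply hw1
      rw [h, inv_pow, hz'] at hz
      rw [← add_inv_eq_zero_iff hw, hz, CharTwo.add_self_eq_zero]
  rw [← Set.ncard_image_of_injective _ (algebraMap F K).injective, himg, Set.ncard_coe_finset,
    Finset.card_image_of_injOn hinj, nthRootsFinset_def,
    Multiset.toFinset_card_of_nodup (hζ.nthRoots_nodup hw), hζ.card_nthRoots,
    if_pos (IsAlgClosed.exists_pow_nat_eq w hm.pos)]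

/-- Here `z ^ (q + 1) = w ^ N ≠ 1`, so `z ^ (q - 1) = 1`. The ratio of two such parameters has order
dividing both `m` and `q - 1`. -/
theorem ncard_dickson_fiber_le_one (h2 : ringChar F = 2) (hb : b ≠ 0)
    (hmN : Fintype.card F + 1 = m * N) (hcop : Nat.Coprime m (Fintype.card F - 1)) {t : F} {w : K}
    (hw : w ≠ 0) (ht : algebraMap F K t = algebraMap F K b ^ m * (w + w⁻¹)) (hwN : w ^ N ≠ 1) :
    {x : F | (dickson 1 (b ^ 2) m).eval x = t}.ncard ≤ 1 := by
  have hφb : algebraMap F K b ≠ 0 := (_root_.map_ne_zero _).2 hb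
  have key : ∀ x : F, (dickson 1 (b ^ 2) m).eval x = t → ∃ z : K, z ≠ 0 ∧ z ^ m = w ∧
      z ^ (Fintype.card F - 1) = 1 ∧ algebraMap F K x = algebraMap F K b * (z + z⁻¹) := by
    intro x hx
    obtain ⟨z, hz, hzw, hzx⟩ := exists_pow_eq_of_dickson_eval_eq hb hw ht hx
    refine ⟨z, hz, hzw, ?_, hzx⟩
    refine (pow_card_add_one_or_of_add_inv h2 hz ⟨x / b, ?_⟩).resolve_left ?_
    · rw [map_div₀, hzx, mul_div_cancel_left₀ _ hφb]
    · rwa [hmN, pow_mul, hzw]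
  rw [Set.ncard_le_one (Set.toFinite _)]
  intro x hx x' hx'
  obtain ⟨z, hz, hzw, hzq, hzx⟩ := key x hx
  obtain ⟨z', hz', hzw', hzq', hzx'⟩ := key x' hx'
  have h1 : (z / z') ^ m = 1 := by rw [div_pow, hzw, hzw', div_self hw]
  have h3 : (z / z') ^ (Fintype.card F - 1) = 1 := by rw [div_pow, hzq, hzq', div_one]
  have h4 : z / z' = 1 := by
    have := pow_gcd_eq_one.2 ⟨h1, h3⟩
    rwa [hcop.gcd_eq_one, pow_one] at this
  apply (algebraMap F K).injective
  rw [hzx, hzx', (div_eq_one_iff_eq hz').1 h4]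

theorem ncard_dickson_split_values (h2 : ringChar F = 2) (hb : b ≠ 0) (hm : Odd m) (hm1 : 1 < m)
    (hN : Odd N) (hmN : Fintype.card F + 1 = m * N)
    (hcop : Nat.Coprime m (Fintype.card F - 1)) :
    {t : F | {x : F | (dickson 1 (b ^ 2) m).eval x = t}.ncard = m}.ncard = N / 2 := by
  classical
  let K := AlgebraicClosure F
  have : CharP F 2 := h2 ▸ ringChar.charP F
  have : CharP K 2 := charP_of_injective_algebraMap (algebraMap F K).injective 2
  obtain ⟨ζ, hζ⟩ := exists_isPrimitiveRoot_of_odd K hN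
  have hφb : algebraMap F K b ≠ 0 := (_root_.map_ne_zero _).2 hb
  have himg : algebraMap F K '' {t : F | {x : F | (dickson 1 (b ^ 2) m).eval x = t}.ncard = m} =
      ((((nthRootsFinset N (1 : K)).image fun z => z + z⁻¹).erase 0).image
        (algebraMap F K b ^ m * ·) : Finset K) := by
    ext y
    simp only [Set.mem_image, Set.mem_ofPred_eq, Finset.coe_image, Finset.mem_coe,
      Finset.mem_erase, Finset.mem_image, mem_nthRootsFinset hN.pos]
    constructor
    · rintro ⟨t, ht, rfl⟩
      -- The zero fibre has `(m + 1) / 2 < m` points.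
      have ht0 : t ≠ 0 := by
        rintro rfl
        rw [ncard_dickson_eval_eq_zero h2 hb hm hmN] at ht
        omega
      obtain ⟨w, hw, htw⟩ := exists_algebraMap_eq_mul_add_inv K (pow_ne_zero m hb) t
      rw [map_pow] at htw
      refine ⟨w + w⁻¹, ⟨?_, w, ?_, rfl⟩, htw.symm⟩
      · intro h
        rw [h, mul_zero, map_eq_zero] at htw
        exact ht0 htw
      · by_contra hwN
        have := ncard_dickson_fiber_le_one h2 hb hmN hcop hw htw hwN
        omega
    · rintro ⟨_, ⟨hw0, w, hwN, rfl⟩, rfl⟩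
      have hw : w ≠ 0 := by
        rintro rfl
        rw [zero_pow hN.pos.ne'] at hwN
        exact zero_ne_one hwN
      obtain ⟨t, ht⟩ := add_inv_mem_range_of_pow_card_add_one (F := F) h2 (z := w)
        (by rw [hmN, mul_comm, pow_mul, hwN, one_pow])
      have htw : algebraMap F K (b ^ m * t) = algebraMap F K b ^ m * (w + w⁻¹) := by
        rw [map_mul, map_pow, ht]
      refine ⟨b ^ m * t, ?_, htw⟩
      refine ncard_dickson_fiber_of_pow_eq_one h2 hb hm hmN hw ?_ htw hwN
      exact fun h => hw0 ((add_inv_eq_zero_iff hw).2 h)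
  have h0 : (0 : K) ∈ (nthRootsFinset N (1 : K)).image fun z => z + z⁻¹ :=
    Finset.mem_image.2 ⟨1, (mem_nthRootsFinset hN.pos 1).2 (one_pow N),
      by rw [inv_one, CharTwo.add_self_eq_zero]⟩
  rw [← Set.ncard_image_of_injective _ (algebraMap F K).injective, himg, Set.ncard_coe_finset,
    Finset.card_image_of_injective _ (mul_right_injective₀ (pow_ne_zero m hφb)),
    Finset.card_erase_of_mem h0, card_image_add_inv_nthRoots hN hζ]
  obtain ⟨L, rfl⟩ := hN
  omega

end DicksonFibers

/-! ### Shifted Dickson polynomials and the main theorem -/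

theorem shiftedDickson_sq {F : Type*} [Field F] [CharP F 2] (m : ℕ) (b : F) :
    shiftedDickson m (b ^ 2) = dickson 1 (b ^ 2) m := by
  have h := dickson_one_eval_add b b m
  rw [CharTwo.add_self_eq_zero, CharTwo.add_self_eq_zero, ← pow_two] at h
  rw [shiftedDickson, h, C_0, sub_zero]

theorem numRoots_add_C {F : Type*} [Field F] [CharP F 2] (f : F[X]) (t : F) :
    numRoots (f + C t) = {x : F | f.eval x = t}.ncard := by
  unfold numRoots
  congr 1
  ext x
  rw [Set.mem_ofPred_eq, Set.mem_ofPred_eq, eval_add, eval_C, CharTwo.add_eq_zero]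

theorem numRoots_splitCount_shiftedDickson {F : Type*} [Field F] [Fintype F] {m L : ℕ}
    (hchar : ringChar F = 2) (hm : Odd m) (hm1 : 1 < m)
    (hq : Fintype.card F + 1 = m * (2 * L + 1)) (hcop : Nat.Coprime m (Fintype.card F - 1))
    {a : F} (ha : a ≠ 0) :
    numRoots (shiftedDickson m a) = (m + 1) / 2 ∧ splitCount (shiftedDickson m a) = L := by
  have : CharP F 2 := hchar ▸ ringChar.charP F
  obtain ⟨b, rfl⟩ := FiniteField.isSquare_of_char_two hchar a
  rw [← pow_two] at ha ⊢
  have hb : b ≠ 0 := by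
    rintro rfl
    simp at ha
  rw [shiftedDickson_sq]
  refine ⟨ncard_dickson_eval_eq_zero hchar hb hm hq, ?_⟩
  unfold splitCount shiftCount
  rw [(dickson_monic_natDegree _ m hm.pos).2]
  simp only [numRoots_add_C]
  rw [ncard_dickson_split_values hchar hb hm hm1 (odd_two_mul_add_one L) hq hcop]
  omega

/-- The condition `s ≠ deg f` keeps `0` out of the split values, so it can be appended without
losing injectivity. -/
theorem exists_fiber_values {F : Type*} [Field F] [Fintype F] [DecidableEq F] [CharP F 2]
    {f : F[X]} {s L : ℕ} (hs : numRoots f = s) (hL : splitCount f = L) (hsm : s ≠ f.natDegree) :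
    ∃ τ : Fin (L + 1) → F, Function.Injective τ ∧ τ (Fin.last L) = 0 ∧
      (∀ i : Fin L, (Finset.univ.filter fun x => f.eval x = τ i.castSucc).card = f.natDegree) ∧
      (Finset.univ.filter fun x => f.eval x = 0).card = s := by
  have hcount : ∀ t : F,
      (Finset.univ.filter fun x => f.eval x = t).card = {x : F | f.eval x = t}.ncard := by
    intro t
    rw [← Set.ncard_coe_finset]
    congr 1
    ext x
    simp
  unfold splitCount shiftCount at hL
  simp only [numRoots_add_C, ← hcount] at hL
  let e := Finite.equivFinOfCardEq hL
  have he : ∀ i, (Finset.univ.filter fun x => f.eval x = (e.symm i).1).card = f.natDegree :=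
    fun i => (e.symm i).2
  have h0 : (Finset.univ.filter fun x => f.eval x = 0).card = s := by rw [hcount, ← hs]; rfl
  refine ⟨Fin.snoc (α := fun _ => F) (fun i => (e.symm i).1) 0, ?_, Fin.snoc_last _ _, ?_, h0⟩
  · rw [Fin.snoc_injective_iff]
    refine ⟨Subtype.val_injective.comp e.symm.injective, ?_⟩
    rintro ⟨i, hi⟩
    apply hsm
    have hi' : (e.symm i).1 = 0 := hi
    rw [← he i, ← h0, hi']
  · intro i
    rw [Fin.snoc_castSucc]
    exact he i

theorem ceil_add_one_div {r M : ℕ} (hr : 0 < r) :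
    ⌈((M : ℚ) + 1) / r⌉ = (M / r : ℕ) + 1 := by
  have hr' : (0 : ℚ) < r := by exact_mod_cast hr
  have h1 := Nat.div_add_mod M r
  have h2 := Nat.mod_lt M hr
  generalize M / r = i at h1 ⊢
  generalize M % r = u at h1 h2
  have h3 : (M : ℚ) = r * i + u := by exact_mod_cast h1.symm
  have h4 : (u : ℚ) + 1 ≤ r := by exact_mod_cast h2
  have h5 : (0 : ℚ) ≤ u := Nat.cast_nonneg _
  rw [Int.ceil_eq_iff]
  push_cast
  rw [lt_div_iff₀ hr', div_le_iff₀ hr']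
  constructor <;> nlinarith

theorem mainTheorem6 {F : Type*} [Field F] [Fintype F] (q m : ℕ) (hq : Fintype.card F = q)
    (hm : 2 < m) (heven : Even q) (hmod : (q : ℤ) ≡ -1 [ZMOD (m : ℤ)]) :
    (∀ a : F, a ≠ 0 →
      numRoots (shiftedDickson m a) = (m + 1) / 2 ∧
      splitCount (shiftedDickson m a) = q / (2 * m)) ∧
    (∀ r δ n k : ℕ, (m + 1) / 2 ≤ r → r ≤ m - 1 → δ = m + 1 - r →
      n = m * (q / (2 * m)) + (m + 1) / 2 →
      r ≤ k → (k : ℤ) ≤ r * (q / (2 * m) : ℕ) + ((m + 1) / 2 : ℕ) - δ + 1 →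
      ∃ C : Submodule F (Fin n → F),
        Module.finrank F C = k ∧
        IsDistanceOptimalLRC C r δ (q / (2 * m)) ((m + 1) / 2) ∧
        (minDistance C : ℤ) =
          n - k - (⌈((k : ℚ) + ((m : ℚ) - 1) / 2) / (r : ℚ)⌉ - 1) * ((δ : ℤ) - 1) + 1) := by
  classical
  have hdvd : m ∣ q + 1 := by
    have h := hmod.dvd
    rw [← Int.natCast_dvd_natCast, ← dvd_neg]
    rwa [show -((q + 1 : ℕ) : ℤ) = -1 - q by push_cast; ring]
  obtain ⟨N, hN⟩ := hdvd
  have hodd : Odd (m * N) := hN ▸ heven.add_one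
  rw [Nat.odd_mul] at hodd
  obtain ⟨hmodd, L, rfl⟩ := hodd
  have hLq : q / (2 * m) = L := by
    rw [show q = (m - 1) + 2 * m * L by
      have : m * (2 * L + 1) = 2 * m * L + m := by ring
      omega, Nat.add_mul_div_left _ _ (by omega), Nat.div_eq_of_lt (by omega), zero_add]
  have hchar : ringChar F = 2 := by
    rw [FiniteField.even_card_iff_char_two, hq]
    exact Nat.even_iff.1 heven
  have hcop : Nat.Coprime m (Fintype.card F - 1) := by
    -- It suffices that `q + 1` and `q - 1` are coprime: they differ by 2 and are odd.
    refine Nat.Coprime.coprime_dvd_left (Dvd.intro _ hN.symm) ?_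
    have hq0 : 0 < q := hq ▸ Fintype.card_pos
    obtain ⟨c, hc⟩ := Nat.exists_eq_add_of_le' hq0
    rw [hq, hc, Nat.add_sub_cancel, add_assoc, Nat.coprime_self_add_left, Nat.coprime_two_left]
    rw [hc, Nat.even_add_one, Nat.not_even_iff_odd] at heven
    exact heven
  have hroots : ∀ a : F, a ≠ 0 →
      numRoots (shiftedDickson m a) = (m + 1) / 2 ∧ splitCount (shiftedDickson m a) = L :=
    fun a ha => numRoots_splitCount_shiftedDickson hchar hmodd (by omega) (hq ▸ hN) hcop ha
  rw [hLq]
  refine ⟨hroots, ?_⟩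
  intro r δ n k hsr hrm hδ hn hrk hk
  have : CharP F 2 := hchar ▸ ringChar.charP F
  obtain ⟨hs, hL⟩ := hroots 1 one_ne_zero
  rw [← one_pow (M := F) 2, shiftedDickson_sq] at hs hL
  obtain ⟨hmon, hdeg⟩ := dickson_monic_natDegree ((1 : F) ^ 2) m (by omega)
  obtain ⟨τ, hτ, hτ0, hτc, hτc0⟩ := exists_fiber_values hs hL (by omega)
  rw [hdeg] at hτc
  obtain ⟨v, rfl⟩ := hmodd
  have hsv : (2 * v + 1 + 1) / 2 = v + 1 := by omega
  rw [hsv] at hsr hn hk hs hτc0 ⊢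
  have hr : 0 < r := by omega
  have hMr := Nat.div_add_mod (k + v - 1) r
  have hMlt := Nat.mod_lt (k + v - 1) hr
  -- With `m = 2v + 1` and `s = v + 1`, the shift `m - s` is `v`; division of the top shifted index
  -- by `r` yields the quotient `l + 1` and the remainder `b`.
  set b := (k + v - 1) % r with hb
  obtain ⟨l, hl⟩ : ∃ l, (k + v - 1) / r = l + 1 :=
    Nat.exists_eq_add_of_le' ((Nat.one_le_div_iff hr).2 (by omega))
  rw [hl] at hMr
  have hlL : l < L := by
    have hk' : k + δ ≤ r * L + (v + 1) + 1 := by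
      zify
      push_cast at hk
      linarith
    -- The bound on `k` gives `k + v - 1 ≤ r * L + (m - δ)`, and `m - δ = r - 1`.
    have h1 : r * (l + 1) < r * (L + 1) := by
      rw [mul_add r L, mul_one]
      omega
    have := Nat.lt_of_mul_lt_mul_left h1
    omega
  have hkb : k + (2 * v + 1 - (v + 1)) = r * (l + 1) + b + 1 := by omega
  obtain ⟨C, hCk, hClrc, hCdis, hCd⟩ := exists_code_of_fibers (r := r) (δ := δ) (k := k) (l := l)
    (b := b) hmon hdeg (by omega) (by omega) (by omega) (by omega) τ hτ hτ0 hτc hτc0 hn hlL hMlt hkb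
  have hbound : ∀ C' : Submodule F (Fin n → F), Module.finrank F C' = k →
      HasDisjointRepairGroups C' r δ L (v + 1) →
      minDistance C' + ((2 * v + 1) * l + (v + 1) + b) ≤ n := by
    intro C' hC' hdis
    have hrδ : r + δ - 1 = 2 * v + 1 := by omega
    have h := hdis.minDistance_add_le (by rw [hn, hrδ]) (by omega) hlL hMlt (by
      rw [hC']
      rw [mul_add, mul_one] at hkb
      omega)
    rwa [hrδ] at h
  have hCd' := hbound C hCk hCdis
  refine ⟨C, hCk, ⟨hClrc, hCdis, ?_⟩, ?_⟩
  · intro C' hC' _ hdis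
    have := hbound C' (hC'.trans hCk) hdis
    omega
  · have hceil : ⌈((k : ℚ) + (((2 * v + 1 : ℕ) : ℚ) - 1) / 2) / (r : ℚ)⌉ = (l : ℤ) + 2 := by
      have h := ceil_add_one_div (M := k + v - 1) hr
      rw [hl] at h
      have h1 : ((k + v - 1 : ℕ) : ℚ) + 1 = (k : ℚ) + (((2 * v + 1 : ℕ) : ℚ) - 1) / 2 := by
        rw [Nat.cast_sub (by omega)]
        push_cast
        ring
      rw [h1] at h
      rw [h]
      push_cast
      ring
    rw [hceil]
    have h1 : (minDistance C : ℤ) = n - ((2 * v + 1) * l + (v + 1) + b) := by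
      have : minDistance C + ((2 * v + 1) * l + (v + 1) + b) = n := le_antisymm hCd' hCd
      zify at this
      linarith
    have h2 : (δ : ℤ) = 2 * v + 2 - r := by omega
    have h3 : (k : ℤ) = r * (l + 1) + b + 1 - v := by
      have : k + v = r * (l + 1) + b + 1 := by omega
      zify at this
      linarith
    rw [h1, h2, h3]
    ring
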